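/- A computer is a partial recursive map from finite binary strings (programs) to finite binary strings whose set of halting programs is prefix-free. A computer $U$ is universal if for every computer $A$ there is a constant $c_A$ such that every string that $A$ prints on a program $p$ is printed by $U$ on some program of length at most $|p|+c_A$. Fix a universal computer $U$, and let $K(s)$ be the length of a shortest program on which $U$ prints the binary string $s$ and halts. For $x\in[0,1]^n$ and $m\ge 0$ let $K^{[\cdot]_m}(x)=K([x_1]_m,\dots,[x_n]_m)$ be the complexity of the binary string of length $nm$ that lists, coordinate by coordinate, the first $m$ bits of the binary expansions of $x_1,\dots,x_n$ (the terminating expansion for dyadic numbers less than $1$, and $1=0.111\ldots$). Let $\kappa\in\mathbb{R}$, $m_n=\lceil\log_2 n\rceil$ and $d_n=\lceil\kappa\log_2 n\rceil$ (read as $0$ if negative). Let $x_o=(x_{o,1},x_{o,2},\dots)\in[0,1]^\infty$, write $x_o^n=(x_{o,1},\dots,x_{o,n})$, and assume $$\limsup_{n\to\infty}\frac{K^{[\cdot]_{m_n}}(x_o^n)}{m_n}\le\kappa .$$ For each $n$ let $A$ be a random $d_n\times n$ matrix with independent $\mathcal N(0,1/d_n)$ entries, and let $\hat x_o^n$ be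 any minimum complexity pursuit estimate, that is, any minimiser of $K^{[\cdot]_{m_n}}(x)$ over all $x\in[0,1]^n$ with $Ax=Ax_o^n$. Then for every $\epsilon>0$ $$\mathbb P\left(\|x_o^n-\hat x_o^n\|_2^2>\epsilon\right)\to0\quad\text{as } n\to\infty .$$ (No measurability of $\hat x_o^n$ in $A$ is assumed; the probability may be read as outer probability.) -/

import Mathlib

open MeasureTheory ProbabilityTheory Filter Topology

/-- A computer: a partial recursive map from binary programs to binary strings whose set of
halting programs is prefix-free (the program is read from a one-way tape). -/
structure IsComputer (A : List Bool →. List Bool) : Prop where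
  partrec : Partrec A
  prefixFree : ∀ p q : List Bool, (A p).Dom → (A q).Dom → p <+: q → p = q

/-- A universal computer: whatever another computer `A` prints by means of a program, `U` prints by
means of a program that is longer by at most a constant depending on `A` only. -/
structure IsUniversalComputer (U : List Bool →. List Bool) : Prop where
  isComputer : IsComputer U
  universal : ∀ A : List Bool →. List Bool, IsComputer A →
    ∃ c : ℕ, ∀ p x : List Bool, x ∈ A p → ∃ q : List Bool, x ∈ U q ∧ q.length ≤ p.length + c

/-- The Kolmogorov complexity of the binary string `x` with respect to `U`: the least length of a
program on which `U` prints `x` and halts. -/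
noncomputable def kolmogorov (U : List Bool →. List Bool) (x : List Bool) : ℕ :=
  sInf {l : ℕ | ∃ p : List Bool, x ∈ U p ∧ p.length = l}

/-- For a universal computer every string has a program, so the infimum above is attained. -/
theorem IsUniversalComputer.exists_program {U : List Bool →. List Bool}
    (hU : IsUniversalComputer U) (x : List Bool) : ∃ p : List Bool, x ∈ U p := by
  let A : List Bool →. List Bool := fun p => bif p.isEmpty then Part.some x else Part.none
  have hdom : ∀ p, (A p).Dom → p = [] := by
    intro p hp
    cases p with
    | nil => rfl
    | cons a t => exact absurd hp (by simp [A])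
  have hA : IsComputer A := by
    refine ⟨?_, fun p q hp hq _ => (hdom p hp).trans (hdom q hq).symm⟩
    have hc : Computable (fun p : List Bool => p.isEmpty) :=
      (Primrec.of_eq (Primrec.beq.comp Primrec.list_length (Primrec.const 0))
        (fun p => by cases p <;> simp)).to_comp
    exact Partrec.cond hc (Computable.const x).partrec Partrec.none
  obtain ⟨c, hc⟩ := hU.universal A hA
  obtain ⟨q, hq, _⟩ := hc [] x (by simp [A])
  exact ⟨q, hq⟩

/-- The bit of weight `2 ^ (-(i + 1))` in the binary expansion of `x ∈ [0, 1]`; the expansion is the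
terminating one if `x < 1` is dyadic, and `1 = 0.111…`. -/
noncomputable def binaryBit (x : ℝ) (i : ℕ) : Bool :=
  if x = 1 then true else decide (⌊(2 : ℝ) ^ (i + 1) * x⌋₊ % 2 = 1)

/-- The binary string `([x₁]_m, …, [xₙ]_m)`: the first `m` bits of every coordinate, one coordinate
after the other. -/
noncomputable def quantizedString {n : ℕ} (m : ℕ) (x : Fin n → ℝ) : List Bool :=
  (List.ofFn fun i : Fin n => List.ofFn fun j : Fin m => binaryBit (x i) j).flatten

/-- The Kolmogorov complexity of `x ∈ [0, 1]ⁿ` at resolution `m`. -/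
noncomputable def kolmogorovAt (U : List Bool →. List Bool) (m : ℕ) {n : ℕ} (x : Fin n → ℝ) : ℕ :=
  kolmogorov U (quantizedString m x)

/-- `xhat` is an output of minimum complexity pursuit at resolution `m` for the measurement matrix
`A` and the measurements `y`: it minimises the complexity at resolution `m` among the
`x ∈ [0, 1]ⁿ` with `A x = y`. -/
def IsMCPOutput (U : List Bool →. List Bool) (m : ℕ) {d n : ℕ} (A : Matrix (Fin d) (Fin n) ℝ)
    (y : Fin d → ℝ) (xhat : Fin n → ℝ) : Prop :=
  (∀ i, xhat i ∈ Set.Icc (0 : ℝ) 1) ∧ A.mulVec xhat = y ∧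
    ∀ x : Fin n → ℝ, (∀ i, x i ∈ Set.Icc (0 : ℝ) 1) → A.mulVec x = y →
      kolmogorovAt U m xhat ≤ kolmogorovAt U m x

/-- The resolution `m_n = ⌈log₂ n⌉`. -/
noncomputable def resolution (n : ℕ) : ℕ := ⌈Real.logb 2 n⌉₊

/-- The number of measurements `d_n = ⌈κ log₂ n⌉`. -/
noncomputable def numMeasurements (κ : ℝ) (n : ℕ) : ℕ := ⌈κ * Real.logb 2 n⌉₊

/-! The truth is feasible, so the estimate has at most its complexity `K`, and its quantization lies
among at most `2 ^ (K + 1)` strings. Fix, independently of `A`, a representative `r` in the box for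
each string. Sharing `m` bits with `2 ^ m ≥ n` puts the estimate `xhat` within squared distance `1 /
n` of its representative, so a large error forces `r` to be far from `x`, while `A (x - r) = A (xhat
- r)`.

The right side is small: ‖Aw‖² ≤ ‖AAᵀ‖_F ‖w‖² (`sum_mulVec_sq_le`), and second moments with Markov's
inequality give ‖AAᵀ‖_F < nt outside an event of probability at most (1/n + c/d)/t². The left side
is rarely small: for a fixed far `r`, ‖A(x - r)‖² ≤ t has probability at most (4et/ε)^(d/2)
(`measure_sum_mulVec_sq_le`), which survives a union bound over the strings. The bad event is thus
covered by events not involving `xhat`, so its measurability plays no role.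

Since `K + 1 ≤ N d`, taking `t = d ^ (-1/4)` sends both terms to zero as `d → ∞`. That `d → ∞` needs
`κ > 0`, which counting programs supplies (`IsUniversalComputer.pos_of_limsup_le`). -/

/-! ### Counting strings of low complexity -/

theorem IsUniversalComputer.exists_program_length_eq {U : List Bool →. List Bool}
    (hU : IsUniversalComputer U) (s : List Bool) :
    ∃ p : List Bool, s ∈ U p ∧ p.length = kolmogorov U s := by
  obtain ⟨p, hp⟩ := hU.exists_program s
  exact Nat.sInf_mem (s := {l : ℕ | ∃ p : List Bool, s ∈ U p ∧ p.length = l}) ⟨_, p, hp, rfl⟩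

/-- Fewer than `2 ^ (l + 1)` binary strings have length at most `l`. -/
theorem exists_finset_length_le (l : ℕ) :
    ∃ T : Finset (List Bool), T.card ≤ 2 ^ (l + 1) ∧ ∀ p : List Bool, p.length ≤ l → p ∈ T := by
  classical
  refine ⟨(Finset.range (l + 1)).biUnion fun i =>
    (Finset.univ : Finset (List.Vector Bool i)).image (fun v => v.toList), ?_, ?_⟩
  · refine Finset.card_biUnion_le.trans ?_
    calc _ ≤ ∑ i ∈ Finset.range (l + 1), 2 ^ i := by
            refine Finset.sum_le_sum fun i _ => Finset.card_image_le.trans ?_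
            simp
      _ ≤ 2 ^ (l + 1) := by
            have := Nat.geomSum_lt (m := 2) (n := l + 1) (s := Finset.range (l + 1)) le_rfl
              (by simp)
            exact this.le
  · intro p hp
    simp only [Finset.mem_biUnion, Finset.mem_range, Finset.mem_image, Finset.mem_univ, true_and]
    exact ⟨p.length, by omega, ⟨p, rfl⟩, rfl⟩

/-- At most `2 ^ (l + 1)` strings have complexity at most `l`. -/
theorem IsUniversalComputer.exists_finset_kolmogorov_le {U : List Bool →. List Bool}
    (hU : IsUniversalComputer U) (l : ℕ) :
    ∃ S : Finset (List Bool), S.card ≤ 2 ^ (l + 1) ∧ ∀ s, kolmogorov U s ≤ l → s ∈ S := by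
  classical
  obtain ⟨T, hT, hmem⟩ := exists_finset_length_le l
  -- The strings are outputs of short programs; the value `[]` on non-halting programs is a harmless
  -- filler.
  refine ⟨T.image fun p => if h : (U p).Dom then (U p).get h else [],
    Finset.card_image_le.trans hT, fun s hs => ?_⟩
  obtain ⟨p, hp, hl⟩ := hU.exists_program_length_eq s
  refine Finset.mem_image.2 ⟨p, hmem p (hl.trans_le hs), ?_⟩
  obtain ⟨h, rfl⟩ := hp
  simp [h]

/-! ### Binary expansions and quantization -/

theorem length_quantizedString {n : ℕ} (m : ℕ) (x : Fin n → ℝ) :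
    (quantizedString m x).length = n * m := by
  simp [quantizedString, Function.comp_def]

theorem binaryBit_eq_of_quantizedString_eq {n m : ℕ} {x y : Fin n → ℝ}
    (h : quantizedString m x = quantizedString m y) (i : Fin n) (j : Fin m) :
    binaryBit (x i) j = binaryBit (y i) j := by
  unfold quantizedString at h
  -- Concatenation can be undone because all blocks have the same length `m`.
  have h' := List.eq_iff_flatten_eq.2 ⟨h, by simp [List.map_ofFn, Function.comp_def]⟩
  exact congrFun (List.ofFn_injective (congrFun (List.ofFn_injective h') i)) j

/-- The integer whose binary digits are the first `m` bits of `x`. -/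
noncomputable def bitsValue (x : ℝ) (m : ℕ) : ℕ :=
  if x = 1 then 2 ^ m - 1 else ⌊(2 : ℝ) ^ m * x⌋₊

/-- Halving and taking floors drops the last binary digit; at `x = 1` this is 2(2^m - 1) + 1 =
2^(m+1) - 1. -/
theorem bitsValue_succ (x : ℝ) (m : ℕ) :
    bitsValue x (m + 1) = 2 * bitsValue x m + (binaryBit x m).toNat := by
  unfold bitsValue binaryBit
  split_ifs with h
  · have := Nat.one_le_two_pow (n := m)
    simp only [Bool.toNat_true, pow_succ]
    omega
  · have hdiv : ⌊(2 : ℝ) ^ (m + 1) * x⌋₊ / 2 = ⌊(2 : ℝ) ^ m * x⌋₊ := by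
      rw [← Nat.floor_div_ofNat]
      congr 1
      rw [pow_succ]
      ring
    have hmod : (decide (⌊(2 : ℝ) ^ (m + 1) * x⌋₊ % 2 = 1)).toNat =
        ⌊(2 : ℝ) ^ (m + 1) * x⌋₊ % 2 := by
      rcases Nat.mod_two_eq_zero_or_one ⌊(2 : ℝ) ^ (m + 1) * x⌋₊ with h | h <;> simp [h]
    rw [hmod, ← hdiv]
    omega

theorem bitsValue_zero {x : ℝ} (hx : x ∈ Set.Icc (0 : ℝ) 1) : bitsValue x 0 = 0 := by
  unfold bitsValue
  split_ifs with h
  · simp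
  · simpa using lt_of_le_of_ne hx.2 h

theorem bitsValue_congr {x y : ℝ} (hx : x ∈ Set.Icc (0 : ℝ) 1) (hy : y ∈ Set.Icc (0 : ℝ) 1)
    {m : ℕ} (h : ∀ j < m, binaryBit x j = binaryBit y j) : bitsValue x m = bitsValue y m := by
  induction m with
  | zero => rw [bitsValue_zero hx, bitsValue_zero hy]
  | succ m ih =>
    rw [bitsValue_succ, bitsValue_succ, ih fun j hj => h j (by omega), h m (by omega)]

/-- The upper inequality is not strict: `x = 1`, with its expansion 0.111…, attains it. -/
theorem bitsValue_le_and_le {x : ℝ} (hx : x ∈ Set.Icc (0 : ℝ) 1) (m : ℕ) :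
    (bitsValue x m : ℝ) ≤ 2 ^ m * x ∧ 2 ^ m * x ≤ bitsValue x m + 1 := by
  unfold bitsValue
  split_ifs with h
  · rw [Nat.cast_sub Nat.one_le_two_pow]
    simp [h]
  · exact ⟨Nat.floor_le (mul_nonneg (by positivity) hx.1), (Nat.lt_floor_add_one _).le⟩

/-- Two points of the unit interval with the same first `m` bits are `2 ^ (-m)`-close. -/
theorem abs_sub_le_of_binaryBit_eq {x y : ℝ} (hx : x ∈ Set.Icc (0 : ℝ) 1)
    (hy : y ∈ Set.Icc (0 : ℝ) 1) {m : ℕ} (h : ∀ j < m, binaryBit x j = binaryBit y j) :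
    |x - y| ≤ (2 ^ m : ℝ)⁻¹ := by
  have hv := bitsValue_congr hx hy h
  obtain ⟨h1, h2⟩ := bitsValue_le_and_le hx m
  obtain ⟨h3, h4⟩ := bitsValue_le_and_le hy m
  rw [← hv] at h3 h4
  have : |(2 : ℝ) ^ m * (x - y)| ≤ 1 := abs_le.2 ⟨by linarith, by linarith⟩
  rw [abs_mul, abs_of_pos (by positivity)] at this
  rwa [← one_div, le_div_iff₀' (by positivity)]

/-! ### Growth of the complexity and positivity of `κ` -/

theorem resolution_of_mem_Ioc {n k : ℕ} (h1 : 2 ^ k < n) (h2 : n ≤ 2 ^ (k + 1)) :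
    resolution n = k + 1 := by
  have hn : (0 : ℝ) < n := by exact_mod_cast (Nat.zero_le _).trans_lt h1
  unfold resolution
  rw [Nat.ceil_eq_iff (by omega)]
  constructor
  · rw [Real.lt_logb_iff_rpow_lt one_lt_two hn, Nat.add_sub_cancel, Real.rpow_natCast]
    exact_mod_cast h1
  · rw [Real.logb_le_iff_le_rpow one_lt_two hn, Real.rpow_natCast]
    exact_mod_cast h2

theorem natCast_le_two_pow_resolution {n : ℕ} (hn : 0 < n) : (n : ℝ) ≤ 2 ^ resolution n := by
  have hn' : (0 : ℝ) < n := by exact_mod_cast hn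
  rw [← Real.rpow_natCast, ← Real.logb_le_iff_le_rpow one_lt_two hn']
  exact Nat.le_ceil _

/-- The complexities at resolution `⌈log₂ n⌉` of the initial segments of a sequence are not
eventually at most `⌈log₂ n⌉ / 2`: there are too few short programs. -/
theorem IsUniversalComputer.not_eventually_kolmogorovAt_le {U : List Bool →. List Bool}
    (hU : IsUniversalComputer U) (x : ℕ → ℝ) :
    ¬ ∀ᶠ n : ℕ in atTop, 2 * kolmogorovAt U (resolution n) (fun i : Fin n => x i) ≤
      resolution n := by
  intro h
  obtain ⟨N, hN⟩ := eventually_atTop.1 h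
  -- From `k ≥ 4` on, `k > (k + 1) / 2 + 1`, so the `2 ^ k` lengths in the dyadic block outnumber
  -- the available strings.
  set k := N + 4 with hk
  have hNk : N ≤ 2 ^ k := by
    have := Nat.lt_two_pow_self (n := k)
    omega
  obtain ⟨S, hS, hmem⟩ := hU.exists_finset_kolmogorov_le ((k + 1) / 2)
  have hcard : (Finset.Ioc (2 ^ k) (2 ^ (k + 1))).card ≤ S.card := by
    refine Finset.card_le_card_of_injOn
      (fun n => quantizedString (resolution n) (fun i : Fin n => x i)) ?_ ?_
    · intro n hn
      obtain ⟨h1, h2⟩ := Finset.mem_Ioc.1 hn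
      have := hN n (by omega)
      rw [resolution_of_mem_Ioc h1 h2] at this
      refine hmem _ ?_
      dsimp only
      rw [resolution_of_mem_Ioc h1 h2]
      unfold kolmogorovAt at this
      omega
    · intro n hn n' hn' heq
      obtain ⟨h1, h2⟩ := Finset.mem_Ioc.1 hn
      obtain ⟨h3, h4⟩ := Finset.mem_Ioc.1 hn'
      have := congrArg List.length heq
      simp only [length_quantizedString, resolution_of_mem_Ioc h1 h2,
        resolution_of_mem_Ioc h3 h4] at this
      -- On the block the resolution is constantly `k + 1`, so the string's length `n * (k + 1)`
      -- reveals `n`.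
      exact Nat.eq_of_mul_eq_mul_right (by omega) this
  rw [Nat.card_Ioc, pow_succ, mul_two, Nat.add_sub_cancel] at hcard
  have := (Nat.pow_le_pow_iff_right (le_refl 2)).1 (hcard.trans hS)
  omega

theorem eventually_kolmogorovAt_le_mul {U : List Bool →. List Bool} {κ : ℝ} {x : ℕ → ℝ}
    (hκ : limsup (fun n : ℕ =>
        (((kolmogorovAt U (resolution n) (fun i : Fin n => x i) : ℝ) / (resolution n : ℝ) : ℝ) :
          EReal)) atTop ≤ (κ : EReal)) {δ : ℝ} (hδ : 0 < δ) :
    ∀ᶠ n : ℕ in atTop, (kolmogorovAt U (resolution n) (fun i : Fin n => x i) : ℝ) ≤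
      (κ + δ) * resolution n := by
  have hlt := hκ.trans_lt (EReal.coe_lt_coe_iff.2 (lt_add_of_pos_right κ hδ))
  filter_upwards [eventually_lt_of_limsup_lt hlt, eventually_ge_atTop 2] with n hn h2
  have hm : 0 < resolution n := Nat.ceil_pos.2 (Real.logb_pos one_lt_two (by exact_mod_cast h2))
  exact (div_le_iff₀ (by exact_mod_cast hm)).1 (EReal.coe_lt_coe_iff.1 hn).le

theorem IsUniversalComputer.pos_of_limsup_le {U : List Bool →. List Bool}
    (hU : IsUniversalComputer U) {κ : ℝ} {x : ℕ → ℝ}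
    (hκ : limsup (fun n : ℕ =>
        (((kolmogorovAt U (resolution n) (fun i : Fin n => x i) : ℝ) / (resolution n : ℝ) : ℝ) :
          EReal)) atTop ≤ (κ : EReal)) : 0 < κ := by
  by_contra! h
  refine hU.not_eventually_kolmogorovAt_le x ?_
  filter_upwards [eventually_kolmogorovAt_le_mul hκ (δ := 1 / 2) (by norm_num)] with n hn
  have : (0 : ℝ) ≤ resolution n := Nat.cast_nonneg _
  have : 2 * (kolmogorovAt U (resolution n) (fun i : Fin n => x i) : ℝ) ≤ resolution n := by
    nlinarith
  exact_mod_cast this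

/-! ### Gram matrix bound -/

/-- The operator norm of a matrix is controlled by the Frobenius norm of its Gram matrix. -/
theorem sum_mulVec_sq_le {d n : ℕ} (A : Matrix (Fin d) (Fin n) ℝ) (w : Fin n → ℝ) :
    ∑ i, (A.mulVec w i) ^ 2 ≤
      √(∑ ij : Fin d × Fin d, (∑ k, A ij.1 k * A ij.2 k) ^ 2) * ∑ k, w k ^ 2 := by
  set u := A.mulVec w with hu
  set G := ∑ ij : Fin d × Fin d, (∑ k, A ij.1 k * A ij.2 k) ^ 2 with hG
  set S := ∑ i, (u i) ^ 2 with hS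
  have hS0 : 0 ≤ S := Finset.sum_nonneg fun i _ => sq_nonneg _
  have hW0 : 0 ≤ ∑ k, w k ^ 2 := Finset.sum_nonneg fun i _ => sq_nonneg _
  -- With `u = Aw`: ‖u‖² = ⟨Aᵀu, w⟩, then Cauchy–Schwarz, and ‖Aᵀu‖² = ⟨u, AAᵀu⟩ ≤ ‖AAᵀ‖_F ‖u‖². One
  -- factor ‖u‖² cancels at the end.
  have h1 : S = ∑ k, (∑ i, A i k * u i) * w k := by
    simp only [Finset.sum_mul]
    rw [Finset.sum_comm]
    refine Finset.sum_congr rfl fun i _ => ?_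
    have hui : u i = ∑ k, A i k * w k := rfl
    calc u i ^ 2 = (∑ k, A i k * w k) * u i := by rw [sq, ← hui]
      _ = _ := by
        rw [Finset.sum_mul]
        exact Finset.sum_congr rfl fun k _ => by ring
  have h2 : S ^ 2 ≤ (∑ k, (∑ i, A i k * u i) ^ 2) * ∑ k, w k ^ 2 := by
    conv_lhs => rw [h1]
    exact Finset.sum_mul_sq_le_sq_mul_sq _ _ _
  have h3 : ∑ k, (∑ i, A i k * u i) ^ 2 =
      ∑ ij : Fin d × Fin d, (∑ k, A ij.1 k * A ij.2 k) * (u ij.1 * u ij.2) := by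
    simp_rw [sq, Finset.sum_mul_sum, Fintype.sum_prod_type, Finset.sum_mul]
    rw [Finset.sum_comm]
    refine Finset.sum_congr rfl fun i _ => ?_
    rw [Finset.sum_comm]
    exact Finset.sum_congr rfl fun j _ => Finset.sum_congr rfl fun k _ => by ring
  have h4 : ∑ ij : Fin d × Fin d, (u ij.1 * u ij.2) ^ 2 = S ^ 2 := by
    rw [hS, sq, Finset.sum_mul_sum, Fintype.sum_prod_type]
    exact Finset.sum_congr rfl fun i _ => Finset.sum_congr rfl fun j _ => by ring
  have h5 : ∑ k, (∑ i, A i k * u i) ^ 2 ≤ √G * S := by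
    rw [h3]
    refine (Real.sum_mul_le_sqrt_mul_sqrt _ _ _).trans ?_
    rw [h4, Real.sqrt_sq hS0]
  have h6 : S * S ≤ (√G * ∑ k, w k ^ 2) * S := by
    nlinarith [mul_le_mul_of_nonneg_right h5 hW0]
  rcases hS0.eq_or_lt with h | h
  · rw [← h]; positivity
  · exact le_of_mul_le_mul_right h6 h

/-! ### Moments and small balls for Gaussian matrices -/

section

variable {Ω : Type*} [MeasurableSpace Ω] {P : Measure Ω}

/-- The fourth moment of a standard Gaussian. -/
noncomputable def gaussianFourthMoment : ℝ := ∫ x, x ^ 4 ∂gaussianReal 0 1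

theorem integral_pow_four_of_hasLaw_gaussianReal {X : Ω → ℝ} {v : NNReal}
    (hX : HasLaw X (gaussianReal 0 v) P) :
    ∫ ω, X ω ^ 4 ∂P = gaussianFourthMoment * (v : ℝ) ^ 2 := by
  have hmap : (gaussianReal 0 1).map (√(v : ℝ) * ·) = gaussianReal 0 v := by
    rw [gaussianReal_map_const_mul]
    congr 1
    · simp
    · ext; simp [Real.sq_sqrt]
  have h1 : ∫ ω, X ω ^ 4 ∂P = ∫ x, x ^ 4 ∂gaussianReal 0 v :=
    hX.integral_comp (f := fun x => x ^ 4) (by fun_prop)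
  rw [h1, ← hmap, integral_map (by fun_prop) (by fun_prop), gaussianFourthMoment,
    ← integral_mul_const]
  congr 1 with x
  have : √(v : ℝ) ^ 4 = (v : ℝ) ^ 2 := by
    rw [show 4 = 2 * 2 from rfl, pow_mul, Real.sq_sqrt v.coe_nonneg]
  rw [mul_pow, this, mul_comm]

theorem integral_sq_of_hasLaw_gaussianReal {X : Ω → ℝ} {v : NNReal}
    (hX : HasLaw X (gaussianReal 0 v) P) : ∫ ω, X ω ^ 2 ∂P = v := by
  have := hX.isProbabilityMeasure
  have h := variance_of_integral_eq_zero hX.aemeasurable (by rw [hX.integral_eq]; simp)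
  rw [← h, hX.variance_eq]
  simp [Function.id_def]

theorem memLp_of_hasLaw_gaussianReal {X : Ω → ℝ} {v : NNReal}
    (hX : HasLaw X (gaussianReal 0 v) P) {p : ENNReal} (hp : p ≠ ⊤) : MemLp X p P :=
  hX.hasGaussianLaw.memLp hp

theorem memLp_two_mul_of_hasLaw_gaussianReal {X Y : Ω → ℝ} {v : NNReal}
    (hX : HasLaw X (gaussianReal 0 v) P) (hY : HasLaw Y (gaussianReal 0 v) P) :
    MemLp (fun ω => X ω * Y ω) 2 P := by
  have : ENNReal.HolderTriple 4 4 2 := ⟨by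
    rw [← two_mul, show (4 : ENNReal) = 2 * 2 by norm_num,
      ENNReal.mul_inv (by simp) (by simp), ← mul_assoc, ENNReal.mul_inv_cancel (by simp) (by simp),
      one_mul]⟩
  exact (memLp_of_hasLaw_gaussianReal hY (p := 4) (by simp)).mul
    (memLp_of_hasLaw_gaussianReal hX (p := 4) (by simp))

section GaussianMatrix

variable {d n : ℕ} {v : NNReal} {A : Ω → Matrix (Fin d) (Fin n) ℝ}

theorem memLp_two_gram (hlaw : ∀ i j, HasLaw (fun ω => A ω i j) (gaussianReal 0 v) P)
    (i j : Fin d) : MemLp (fun ω => ∑ k, A ω i k * A ω j k) 2 P :=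
  memLp_finsetSum _ fun k _ => memLp_two_mul_of_hasLaw_gaussianReal (hlaw i k) (hlaw j k)

/-- Cauchy–Schwarz over the row; only the order n²v² matters, so no independence is needed. -/
theorem integral_gram_diag_sq_le (hlaw : ∀ i j, HasLaw (fun ω => A ω i j) (gaussianReal 0 v) P)
    (i : Fin d) :
    ∫ ω, (∑ k, A ω i k * A ω i k) ^ 2 ∂P ≤ gaussianFourthMoment * n ^ 2 * (v : ℝ) ^ 2 := by
  have hint : ∀ k, Integrable (fun ω => A ω i k ^ 4) P := fun k => by
    have := (memLp_two_mul_of_hasLaw_gaussianReal (hlaw i k) (hlaw i k)).integrable_sq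
    refine this.congr (ae_of_all _ fun ω => ?_)
    dsimp only
    ring
  calc ∫ ω, (∑ k, A ω i k * A ω i k) ^ 2 ∂P ≤ ∫ ω, n * ∑ k, A ω i k ^ 4 ∂P := by
        refine integral_mono (memLp_two_gram hlaw i i).integrable_sq
          ((integrable_finsetSum _ fun k _ => hint k).const_mul _) fun ω => ?_
        dsimp only
        refine (sq_sum_le_card_mul_sum_sq (s := Finset.univ)).trans (le_of_eq ?_)
        rw [Finset.card_univ, Fintype.card_fin]
        congr 1
        exact Finset.sum_congr rfl fun k _ => by ring
    _ = gaussianFourthMoment * n ^ 2 * (v : ℝ) ^ 2 := by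
        rw [integral_const_mul, integral_finsetSum _ fun k _ => hint k]
        simp only [integral_pow_four_of_hasLaw_gaussianReal (hlaw i _), Finset.sum_const,
          Finset.card_univ, Fintype.card_fin, nsmul_eq_mul]
        ring

/-- The entry is a sum of centred, pairwise independent products, so variances add and the order is
`n` rather than `n ^ 2`. -/
theorem integral_gram_offDiag_sq
    (hindep : iIndepFun (fun (ij : Fin d × Fin n) (ω : Ω) => A ω ij.1 ij.2) P)
    (hlaw : ∀ i j, HasLaw (fun ω => A ω i j) (gaussianReal 0 v) P) {i j : Fin d} (hij : i ≠ j) :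
    ∫ ω, (∑ k, A ω i k * A ω j k) ^ 2 ∂P = n * (v : ℝ) ^ 2 := by
  have := hindep.isProbabilityMeasure
  have hae : ∀ ij : Fin d × Fin n, AEMeasurable (fun ω => A ω ij.1 ij.2) P :=
    fun ij => (hlaw _ _).aemeasurable
  have hmem : ∀ k, MemLp (fun ω => A ω i k * A ω j k) 2 P :=
    fun k => memLp_two_mul_of_hasLaw_gaussianReal (hlaw i k) (hlaw j k)
  have hind : ∀ k, IndepFun (fun ω => A ω i k) (fun ω => A ω j k) P := fun k =>
    hindep.indepFun (i := (i, k)) (j := (j, k)) (by simp [hij])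
  have hmean : ∀ k, ∫ ω, A ω i k * A ω j k ∂P = 0 := fun k => by
    rw [(hind k).integral_fun_mul_eq_mul_integral (hlaw _ _).aemeasurable.aestronglyMeasurable
      (hlaw _ _).aemeasurable.aestronglyMeasurable, (hlaw i k).integral_eq]
    simp
  have hsum0 : ∫ ω, (∑ k, fun ω => A ω i k * A ω j k) ω ∂P = 0 := by
    simp only [Finset.sum_apply]
    rw [integral_finsetSum _ fun k _ => (hmem k).integrable (by norm_num)]
    simp [hmean]
  have hvar := IndepFun.variance_sum (μ := P) (s := Finset.univ)
    (X := fun k ω => A ω i k * A ω j k) (fun k _ => hmem k) (by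
      intro k _ l _ hkl
      exact hindep.indepFun_mul_mul₀ hae (i, k) (j, k) (i, l) (j, l) (by simp [hkl])
        (by simp [hij]) (by simp [hij.symm]) (by simp [hkl]))
  rw [variance_of_integral_eq_zero (memLp_finsetSum' _ fun k _ => hmem k).aemeasurable hsum0]
    at hvar
  simp only [Finset.sum_apply] at hvar
  rw [hvar]
  have hterm : ∀ k, variance (fun ω => A ω i k * A ω j k) P = (v : ℝ) ^ 2 := fun k => by
    rw [variance_of_integral_eq_zero (hmem k).aemeasurable (hmean k)]
    have hsq : IndepFun (fun ω => A ω i k ^ 2) (fun ω => A ω j k ^ 2) P :=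
      (hind k).comp (φ := fun x => x ^ 2) (ψ := fun x => x ^ 2) (by fun_prop) (by fun_prop)
    simp only [mul_pow]
    rw [hsq.integral_fun_mul_eq_mul_integral
      ((hlaw _ _).aemeasurable.pow_const 2).aestronglyMeasurable
      ((hlaw _ _).aemeasurable.pow_const 2).aestronglyMeasurable,
      integral_sq_of_hasLaw_gaussianReal (hlaw i k), integral_sq_of_hasLaw_gaussianReal (hlaw j k),
      sq]
  simp [hterm]

/-- Only the `d` diagonal entries cost `n ^ 2`; with `v = 1 / d` the total is n + cn²/d, which is
o(n²) as n, d → ∞. -/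
theorem integral_gram_frobenius_sq_le
    (hindep : iIndepFun (fun (ij : Fin d × Fin n) (ω : Ω) => A ω ij.1 ij.2) P)
    (hlaw : ∀ i j, HasLaw (fun ω => A ω i j) (gaussianReal 0 v) P) :
    ∫ ω, ∑ ij : Fin d × Fin d, (∑ k, A ω ij.1 k * A ω ij.2 k) ^ 2 ∂P ≤
      (d ^ 2 * n + gaussianFourthMoment * d * n ^ 2) * (v : ℝ) ^ 2 := by
  rw [integral_finsetSum _ fun ij _ => (memLp_two_gram hlaw ij.1 ij.2).integrable_sq]
  calc _ ≤ ∑ ij : Fin d × Fin d, (n * (v : ℝ) ^ 2 +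
          if ij.1 = ij.2 then gaussianFourthMoment * n ^ 2 * (v : ℝ) ^ 2 else 0) := by
        refine Finset.sum_le_sum fun ij _ => ?_
        split_ifs with h
        · rw [h]
          exact (integral_gram_diag_sq_le hlaw _).trans (le_add_of_nonneg_left (by positivity))
        · rw [integral_gram_offDiag_sq hindep hlaw h, add_zero]
    _ = _ := by
        rw [Finset.sum_add_distrib, Fintype.sum_prod_type, Fintype.sum_prod_type]
        simp
        ring

theorem measure_gram_frobenius_sq_ge_le
    (hindep : iIndepFun (fun (ij : Fin d × Fin n) (ω : Ω) => A ω ij.1 ij.2) P)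
    (hlaw : ∀ i j, HasLaw (fun ω => A ω i j) (gaussianReal 0 v) P) {t : ℝ} (ht : 0 < t) :
    P {ω | t ≤ ∑ ij : Fin d × Fin d, (∑ k, A ω ij.1 k * A ω ij.2 k) ^ 2} ≤
      ENNReal.ofReal ((d ^ 2 * n + gaussianFourthMoment * d * n ^ 2) * (v : ℝ) ^ 2 / t) := by
  have := hindep.isProbabilityMeasure
  have hM := mul_meas_ge_le_integral_of_nonneg (μ := P)
    (f := fun ω => ∑ ij : Fin d × Fin d, (∑ k, A ω ij.1 k * A ω ij.2 k) ^ 2)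
    (ae_of_all _ fun ω => Finset.sum_nonneg fun _ _ => sq_nonneg _)
    (integrable_finsetSum _ fun ij _ => (memLp_two_gram hlaw ij.1 ij.2).integrable_sq) t
  rw [← ofReal_measureReal]
  refine ENNReal.ofReal_le_ofReal ?_
  rw [le_div_iff₀' ht]
  exact hM.trans (integral_gram_frobenius_sq_le hindep hlaw)

theorem hasGaussianLaw_mulVec
    (hindep : iIndepFun (fun (ij : Fin d × Fin n) (ω : Ω) => A ω ij.1 ij.2) P)
    (hlaw : ∀ i j, HasLaw (fun ω => A ω i j) (gaussianReal 0 v) P) (x : Fin n → ℝ) :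
    HasGaussianLaw (fun ω i => (A ω).mulVec x i) P := by
  have h := iIndepFun.hasGaussianLaw
    (fun ij : Fin d × Fin n => (hlaw ij.1 ij.2).hasGaussianLaw) hindep
  let L : (Fin d × Fin n → ℝ) →L[ℝ] (Fin d → ℝ) :=
    ContinuousLinearMap.pi fun i => ∑ j, x j • ContinuousLinearMap.proj (i, j)
  refine (h.map_fun L).congr (ae_of_all _ fun ω => ?_)
  ext i
  simp [L, Matrix.mulVec, dotProduct, mul_comm]

/-- The coordinates are jointly Gaussian, so vanishing covariance between distinct rows suffices. -/
theorem iIndepFun_mulVec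
    (hindep : iIndepFun (fun (ij : Fin d × Fin n) (ω : Ω) => A ω ij.1 ij.2) P)
    (hlaw : ∀ i j, HasLaw (fun ω => A ω i j) (gaussianReal 0 v) P) (x : Fin n → ℝ) :
    iIndepFun (fun i ω => (A ω).mulVec x i) P := by
  have := hindep.isProbabilityMeasure
  refine (hasGaussianLaw_mulVec hindep hlaw x).iIndepFun_of_covariance_eq_zero fun i j hij => ?_
  simp only [Matrix.mulVec, dotProduct]
  have hmem : ∀ i k, MemLp (fun ω => A ω i k * x k) 2 P := fun i k =>
    (memLp_of_hasLaw_gaussianReal (hlaw i k) (by simp)).mul_const _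
  rw [covariance_fun_sum_fun_sum (fun k => hmem i k) (fun k => hmem j k)]
  refine Finset.sum_eq_zero fun k _ => Finset.sum_eq_zero fun l _ => ?_
  have hI : IndepFun (fun ω => A ω i k) (fun ω => A ω j l) P :=
    hindep.indepFun (i := (i, k)) (j := (j, l)) (by simp [hij])
  have hI' := hI.comp (φ := fun y => y * x k) (ψ := fun y => y * x l) (by fun_prop) (by fun_prop)
  exact hI'.covariance_eq_zero (hmem i k) (hmem j l)

theorem hasLaw_mulVec
    (hindep : iIndepFun (fun (ij : Fin d × Fin n) (ω : Ω) => A ω ij.1 ij.2) P)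
    (hlaw : ∀ i j, HasLaw (fun ω => A ω i j) (gaussianReal 0 v) P) (x : Fin n → ℝ) (i : Fin d) :
    HasLaw (fun ω => (A ω).mulVec x i) (gaussianReal 0 (v * ∑ k, x k ^ 2).toNNReal) P := by
  have := hindep.isProbabilityMeasure
  have hG := (hasGaussianLaw_mulVec hindep hlaw x).eval i
  have hmem : ∀ k, MemLp (fun ω => A ω i k * x k) 2 P := fun k =>
    (memLp_of_hasLaw_gaussianReal (hlaw i k) (by simp)).mul_const _
  refine ⟨hG.aemeasurable, ?_⟩
  have hmean : ∫ ω, (A ω).mulVec x i ∂P = 0 := by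
    simp only [Matrix.mulVec, dotProduct]
    rw [integral_finsetSum _ fun k _ => (hmem k).integrable (by norm_num)]
    refine Finset.sum_eq_zero fun k _ => ?_
    rw [integral_mul_const, (hlaw i k).integral_eq]
    simp
  have hvar : variance (fun ω => (A ω).mulVec x i) P = v * ∑ k, x k ^ 2 := by
    have hs := IndepFun.variance_sum (μ := P) (s := Finset.univ)
      (X := fun k ω => A ω i k * x k) (fun k _ => hmem k) (by
        intro k _ l _ hkl
        have hI : IndepFun (fun ω => A ω i k) (fun ω => A ω i l) P :=
          hindep.indepFun (i := (i, k)) (j := (i, l)) (by simp [hkl])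
        exact hI.comp (φ := fun y => y * x k) (ψ := fun y => y * x l) (by fun_prop) (by fun_prop))
    have hfun : (fun ω => (A ω).mulVec x i) = ∑ k, fun ω => A ω i k * x k := by
      ext ω
      simp [Matrix.mulVec, dotProduct]
    rw [hfun, hs, Finset.mul_sum]
    refine Finset.sum_congr rfl fun k _ => ?_
    rw [variance_mul_const, (hlaw i k).variance_eq]
    simp [Function.id_def]
  rw [hG.map_eq_gaussianReal, hmean, hvar]

end GaussianMatrix

/-- Bounding the density by its peak leaves a pure Gaussian integral: (2πv)^(-1/2) (π/b)^(1/2). -/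
theorem integral_exp_neg_mul_sq_gaussianReal_le {v : NNReal} (hv : v ≠ 0) {b : ℝ} (hb : 0 < b) :
    ∫ x, Real.exp (-b * x ^ 2) ∂gaussianReal 0 v ≤ (√(2 * b * v))⁻¹ := by
  rw [integral_gaussianReal_eq_integral_smul hv]
  have hv0 : (0 : ℝ) < v := by positivity
  have hle : ∀ x, gaussianPDFReal 0 v x ≤ (√(2 * Real.pi * v))⁻¹ := fun x => by
    rw [gaussianPDFReal]
    refine mul_le_of_le_one_right (by positivity) (Real.exp_le_one_iff.2 ?_)
    rw [neg_div]
    exact neg_nonpos.2 (by positivity)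
  have hint := integrable_exp_neg_mul_sq hb
  calc _ ≤ ∫ x, (√(2 * Real.pi * v))⁻¹ * Real.exp (-b * x ^ 2) := by
        refine integral_mono_of_nonneg (ae_of_all _ fun x => ?_) (hint.const_mul _)
          (ae_of_all _ fun x => ?_)
        · exact mul_nonneg (gaussianPDFReal_nonneg _ _ _) (Real.exp_pos _).le
        · exact mul_le_mul_of_nonneg_right (hle x) (Real.exp_pos _).le
    _ = (√(2 * b * v))⁻¹ := by
        rw [integral_const_mul, integral_gaussian, ← Real.sqrt_inv, ← Real.sqrt_mul (by positivity),
          ← Real.sqrt_inv]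
        congr 1
        field_simp

/-- Small ball estimate for the image of a fixed vector under a Gaussian matrix. -/
theorem measure_sum_mulVec_sq_le {d n : ℕ} {v : NNReal} {A : Ω → Matrix (Fin d) (Fin n) ℝ}
    (hindep : iIndepFun (fun (ij : Fin d × Fin n) (ω : Ω) => A ω ij.1 ij.2) P)
    (hlaw : ∀ i j, HasLaw (fun ω => A ω i j) (gaussianReal 0 v) P) {x : Fin n → ℝ}
    (hx : 0 < v * ∑ k, x k ^ 2) (hd : 0 < d) {t : ℝ} (ht : 0 < t) :
    P {ω | ∑ i, ((A ω).mulVec x i) ^ 2 ≤ t} ≤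
      ENNReal.ofReal (√(Real.exp 1 * t / (d * (v * ∑ k, x k ^ 2))) ^ d) := by
  have := hindep.isProbabilityMeasure
  set s : ℝ := v * ∑ k, x k ^ 2 with hs
  have hd' : (0 : ℝ) < d := by exact_mod_cast hd
  -- The Chernoff parameter minimising e^(bt) (2bs)^(-d/2).
  set b : ℝ := d / (2 * t) with hb
  have hb0 : 0 < b := by positivity
  have hlaw' := hasLaw_mulVec hindep hlaw x
  have hind : iIndepFun (fun i ω => ((A ω).mulVec x i) ^ 2) P :=
    (iIndepFun_mulVec hindep hlaw x).comp (fun _ y => y ^ 2) fun _ => by fun_prop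
  have hae : ∀ i, AEMeasurable (fun ω => ((A ω).mulVec x i) ^ 2) P := fun i =>
    (hlaw' i).aemeasurable.pow_const 2
  have hmgf : ∀ i, mgf (fun ω => ((A ω).mulVec x i) ^ 2) P (-b) ≤ (√(2 * b * s))⁻¹ := fun i => by
    have h1 : mgf (fun ω => ((A ω).mulVec x i) ^ 2) P (-b) =
        ∫ y, Real.exp (-b * y ^ 2) ∂gaussianReal 0 s.toNNReal :=
      (hlaw' i).integral_comp (f := fun y => Real.exp (-b * y ^ 2)) (by fun_prop)
    rw [h1]
    refine (integral_exp_neg_mul_sq_gaussianReal_le (by simpa using hx) hb0).trans ?_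
    rw [Real.coe_toNNReal _ hx.le]
  have hfun : (∑ i, fun ω => ((A ω).mulVec x i) ^ 2) =
      fun ω => ∑ i, ((A ω).mulVec x i) ^ 2 := by
    ext ω
    simp
  have hint : Integrable (fun ω => Real.exp (-b * ∑ i, ((A ω).mulVec x i) ^ 2)) P := by
    refine Integrable.of_bound (C := 1) ?_ (ae_of_all _ fun ω => ?_)
    · exact ((Finset.aemeasurable_fun_sum _ fun i _ => hae i).const_mul _).exp.aestronglyMeasurable
    · rw [Real.norm_of_nonneg (Real.exp_pos _).le, Real.exp_le_one_iff]
      exact mul_nonpos_of_nonpos_of_nonneg (by linarith)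
        (Finset.sum_nonneg fun _ _ => sq_nonneg _)
  have hC := measure_le_le_exp_mul_mgf (μ := P) t (by linarith : -b ≤ 0) hint
  rw [← hfun, hind.mgf_sum₀ hae] at hC
  rw [← ofReal_measureReal]
  refine ENNReal.ofReal_le_ofReal (hC.trans ?_)
  calc _ ≤ Real.exp (- -b * t) * ∏ _i : Fin d, (√(2 * b * s))⁻¹ := by
        gcongr with i
        · exact fun i _ => mgf_nonneg
        · exact hmgf i
    _ = _ := by
        have h1 : Real.exp (- -b * t) = √(Real.exp 1) ^ d := by
          rw [← Real.exp_half, ← Real.exp_nat_mul]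
          congr 1
          rw [hb]
          field_simp
        rw [h1, Finset.prod_const, Finset.card_univ, Fintype.card_fin, ← mul_pow, ← Real.sqrt_inv,
          ← Real.sqrt_mul (Real.exp_pos _).le]
        congr 2
        rw [hb]
        field_simp

end

/-! ### Error bound at fixed dimension -/

/-- Non-asymptotic guarantee for minimum complexity pursuit. -/
theorem IsUniversalComputer.measure_mcp_error_le {U : List Bool →. List Bool}
    (hU : IsUniversalComputer U) {Ω : Type*} [MeasurableSpace Ω] {P : Measure Ω} {d n m : ℕ}
    (hd : 0 < d) (hn : 0 < n) (hm : (n : ℝ) ≤ 2 ^ m)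
    {A : Ω → Matrix (Fin d) (Fin n) ℝ}
    (hindep : iIndepFun (fun (ij : Fin d × Fin n) (ω : Ω) => A ω ij.1 ij.2) P)
    (hlaw : ∀ i j, HasLaw (fun ω => A ω i j) (gaussianReal 0 (1 / (d : NNReal))) P)
    {x : Fin n → ℝ} (hx : ∀ i, x i ∈ Set.Icc (0 : ℝ) 1) {xhat : Ω → Fin n → ℝ}
    (hxhat : ∀ ω, IsMCPOutput U m (A ω) ((A ω).mulVec x) (xhat ω))
    {ε t : ℝ} (ht : 0 < t) (hε : 0 < ε) (hεn : 4 ≤ ε * n) :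
    P {ω | ε < ∑ i, (x i - xhat ω i) ^ 2} ≤
      ENNReal.ofReal ((1 / n + gaussianFourthMoment / d) / t ^ 2) +
        ENNReal.ofReal (2 ^ (kolmogorovAt U m x + 1) * √(4 * Real.exp 1 / ε * t) ^ d) := by
  classical
  have hd' : (0 : ℝ) < d := by exact_mod_cast hd
  have hn' : (0 : ℝ) < n := by exact_mod_cast hn
  obtain ⟨S, hS, hmem⟩ := hU.exists_finset_kolmogorov_le (kolmogorovAt U m x)
  -- The representative depends on the string alone, not on `ω`, so the small ball estimate applies
  -- to a fixed vector. Strings that quantize no point of the box get an arbitrary value.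
  have hrep : ∀ s : List Bool, ∃ y : Fin n → ℝ,
      (∃ z : Fin n → ℝ, (∀ i, z i ∈ Set.Icc (0 : ℝ) 1) ∧ quantizedString m z = s) →
        (∀ i, y i ∈ Set.Icc (0 : ℝ) 1) ∧ quantizedString m y = s := by
    intro s
    by_cases h : ∃ z : Fin n → ℝ, (∀ i, z i ∈ Set.Icc (0 : ℝ) 1) ∧ quantizedString m z = s
    · obtain ⟨z, hz⟩ := h
      exact ⟨z, fun _ => hz⟩
    · exact ⟨0, fun h' => absurd h' h⟩
  choose r hr using hrep
  set S' := S.filter fun s => ε / 4 < ∑ i, (x i - r s i) ^ 2 with hS'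
  have hsub : {ω | ε < ∑ i, (x i - xhat ω i) ^ 2} ⊆
      {ω | (n * t) ^ 2 ≤ ∑ ij : Fin d × Fin d, (∑ k, A ω ij.1 k * A ω ij.2 k) ^ 2} ∪
        ⋃ s ∈ S', {ω | ∑ i, ((A ω).mulVec (x - r s) i) ^ 2 ≤ t} := by
    intro ω hω
    by_contra hcon
    simp only [Set.mem_union, Set.mem_ofPred_eq, Set.mem_iUnion, not_or, not_le, not_exists] at hcon
    obtain ⟨hF, hball⟩ := hcon
    obtain ⟨hbox, hAx, hmin⟩ := hxhat ω
    set s := quantizedString m (xhat ω) with hs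
    have hsS : s ∈ S := hmem s (hmin x hx rfl)
    obtain ⟨hrbox, hrs⟩ := hr s ⟨xhat ω, hbox, rfl⟩
    have hclose : ∀ k, (xhat ω - r s) k ^ 2 ≤ ((n : ℝ)⁻¹) ^ 2 := fun k => by
      have h1 := abs_sub_le_of_binaryBit_eq (hbox k) (hrbox k) (m := m)
        fun j hj => binaryBit_eq_of_quantizedString_eq (hs.symm.trans hrs.symm) k ⟨j, hj⟩
      rw [← sq_abs]
      exact pow_le_pow_left₀ (abs_nonneg _) (h1.trans (inv_anti₀ hn' hm)) 2
    have hw : ∑ k, (xhat ω - r s) k ^ 2 ≤ (n : ℝ)⁻¹ := by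
      refine (Finset.sum_le_card_nsmul _ _ _ fun k _ => hclose k).trans (le_of_eq ?_)
      rw [Finset.card_univ, Fintype.card_fin, nsmul_eq_mul]
      field_simp
    have hsS' : s ∈ S' := by
      refine Finset.mem_filter.2 ⟨hsS, ?_⟩
      -- From (a + b)² ≤ 2a² + 2b²: as 1/n ≤ ε/4, an error above `ε` leaves more than ε/4 for `x - r
      -- s`.
      have h1 : ∑ i, (x i - xhat ω i) ^ 2 ≤
          2 * ∑ i, (x i - r s i) ^ 2 + 2 * ∑ k, (xhat ω - r s) k ^ 2 := by
        rw [Finset.mul_sum, Finset.mul_sum, ← Finset.sum_add_distrib]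
        refine Finset.sum_le_sum fun i _ => ?_
        rw [Pi.sub_apply]
        nlinarith [sq_nonneg (x i - r s i + (xhat ω i - r s i))]
      have h2 : (n : ℝ)⁻¹ ≤ ε / 4 := by
        rw [inv_le_iff_one_le_mul₀ hn']
        linarith
      have h3 : ε < ∑ i, (x i - xhat ω i) ^ 2 := hω
      linarith
    refine absurd (hball s hsS') (not_lt.2 ?_)
    have hA : (A ω).mulVec (x - r s) = (A ω).mulVec (xhat ω - r s) := by
      rw [Matrix.mulVec_sub, Matrix.mulVec_sub, hAx]
    rw [hA]
    refine (sum_mulVec_sq_le _ _).trans ?_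
    calc _ ≤ (n * t) * (n : ℝ)⁻¹ := by
          refine mul_le_mul ?_ hw (Finset.sum_nonneg fun _ _ => sq_nonneg _) (by positivity)
          exact Real.sqrt_le_iff.2 ⟨by positivity, hF.le⟩
      _ = t := by field_simp
  refine (measure_mono hsub).trans ((measure_union_le _ _).trans (add_le_add ?_ ?_))
  · refine (measure_gram_frobenius_sq_ge_le hindep hlaw (by positivity)).trans (le_of_eq ?_)
    congr 1
    push_cast
    field_simp
  · have hterm : ∀ s ∈ S', P {ω | ∑ i, ((A ω).mulVec (x - r s) i) ^ 2 ≤ t} ≤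
        ENNReal.ofReal (√(4 * Real.exp 1 / ε * t) ^ d) := fun s hs => by
      have hlt : ε / 4 < ∑ k, (x - r s) k ^ 2 := (Finset.mem_filter.1 hs).2
      have hpos : 0 < ∑ k, (x - r s) k ^ 2 := (by positivity : 0 < ε / 4).trans hlt
      refine (measure_sum_mulVec_sq_le hindep hlaw (by push_cast; positivity) hd ht).trans
        (ENNReal.ofReal_le_ofReal ?_)
      refine pow_le_pow_left₀ (Real.sqrt_nonneg _) (Real.sqrt_le_sqrt ?_) d
      push_cast
      rw [one_div, mul_inv_cancel_left₀ hd'.ne', div_le_iff₀ hpos]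
      calc Real.exp 1 * t = 4 * Real.exp 1 / ε * t * (ε / 4) := by field_simp
        _ ≤ _ := mul_le_mul_of_nonneg_left hlt.le (by positivity)
    refine (measure_biUnion_finset_le _ _).trans ((Finset.sum_le_card_nsmul _ _ _ hterm).trans ?_)
    rw [ENNReal.ofReal_mul (by positivity), nsmul_eq_mul]
    refine mul_le_mul_left ?_ _
    have hc : S'.card ≤ 2 ^ (kolmogorovAt U m x + 1) := (Finset.card_filter_le _ _).trans hS
    rw [← ENNReal.ofReal_natCast]
    exact ENNReal.ofReal_le_ofReal (by exact_mod_cast hc)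

/-! ### Asymptotics -/

theorem tendsto_numMeasurements {κ : ℝ} (hκ : 0 < κ) : Tendsto (numMeasurements κ) atTop atTop :=
  tendsto_nat_ceil_atTop.comp
    (((Real.tendsto_logb_atTop one_lt_two).comp tendsto_natCast_atTop_atTop).const_mul_atTop hκ)

theorem eventually_numMeasurements_le (κ : ℝ) : ∀ᶠ n : ℕ in atTop, numMeasurements κ n ≤ n := by
  have h1 : (fun x : ℝ => κ * Real.logb 2 x) =o[atTop] (fun x : ℝ => x) := by
    refine ((Real.isLittleO_log_id_atTop.const_mul_left (κ / Real.log 2))).congr_left fun x => ?_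
    rw [Real.logb]
    ring
  filter_upwards [tendsto_natCast_atTop_atTop.eventually (h1.bound one_pos)] with n hn
  refine Nat.ceil_le.2 ((le_abs_self _).trans ?_)
  simpa using hn

theorem tendsto_pow_self_of_tendsto_zero {u : ℕ → ℝ} (hu0 : ∀ n, 0 ≤ u n)
    (hu : Tendsto u atTop (𝓝 0)) : Tendsto (fun n => u n ^ n) atTop (𝓝 0) := by
  refine tendsto_of_tendsto_of_tendsto_of_le_of_le' tendsto_const_nhds
    (tendsto_pow_atTop_nhds_zero_of_lt_one (r := (1 / 2 : ℝ)) (by norm_num) (by norm_num))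
    (Eventually.of_forall fun n => pow_nonneg (hu0 n) n) ?_
  filter_upwards [hu.eventually_le_const (by norm_num : (0 : ℝ) < 1 / 2)] with n hn
  exact pow_le_pow_left₀ (hu0 n) hn n

/-- If the complexity is `O(log n)` at resolution `⌈log₂ n⌉`, it is at most a constant times the
number of measurements. -/
theorem exists_eventually_kolmogorovAt_le_numMeasurements {U : List Bool →. List Bool} {κ : ℝ}
    (hpos : 0 < κ) {x : ℕ → ℝ}
    (hκ : limsup (fun n : ℕ =>
        (((kolmogorovAt U (resolution n) (fun i : Fin n => x i) : ℝ) / (resolution n : ℝ) : ℝ) :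
          EReal)) atTop ≤ (κ : EReal)) :
    ∃ N : ℕ, ∀ᶠ n : ℕ in atTop,
      kolmogorovAt U (resolution n) (fun i : Fin n => x i) + 1 ≤ N * numMeasurements κ n := by
  -- Eventually K ≤ (κ + 1)m, m ≤ log₂ n + 1, log₂ n ≤ d/κ and 1 ≤ d; the final `+ 1` absorbs the
  -- one in `K + 1`.
  refine ⟨⌈(κ + 1) * (1 / κ + 1) + 1⌉₊, ?_⟩
  filter_upwards [eventually_kolmogorovAt_le_mul hκ one_pos, eventually_ge_atTop 1,
    (tendsto_numMeasurements hpos).eventually_ge_atTop 1] with n hn hn1 hd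
  have hd' : (1 : ℝ) ≤ numMeasurements κ n := by exact_mod_cast hd
  have hL : 0 ≤ Real.logb 2 n := Real.logb_nonneg one_lt_two (by exact_mod_cast hn1)
  have hm : (resolution n : ℝ) ≤ Real.logb 2 n + 1 := (Nat.ceil_lt_add_one hL).le
  have hLd : Real.logb 2 n ≤ 1 / κ * numMeasurements κ n := by
    rw [div_mul_eq_mul_div, one_mul, le_div_iff₀' hpos]
    exact Nat.le_ceil _
  have h1 : (κ + 1) * resolution n ≤ (κ + 1) * ((1 / κ + 1) * numMeasurements κ n) :=
    mul_le_mul_of_nonneg_left (by linarith) (by linarith)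
  have h2 : ((kolmogorovAt U (resolution n) (fun i : Fin n => x i) + 1 : ℕ) : ℝ) ≤
      ((κ + 1) * (1 / κ + 1) + 1) * numMeasurements κ n := by
    push_cast
    linarith
  have h3 := h2.trans (mul_le_mul_of_nonneg_right (Nat.le_ceil _) (by linarith))
  exact_mod_cast h3

theorem theorem1 (U : List Bool →. List Bool) (hU : IsUniversalComputer U)
    (κ : ℝ) (xo : ℕ → ℝ) (hxo : ∀ i, xo i ∈ Set.Icc (0 : ℝ) 1)
    (hκ : limsup (fun n : ℕ =>
        (((kolmogorovAt U (resolution n) (fun i : Fin n => xo i) : ℝ) / (resolution n : ℝ) : ℝ) :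
          EReal)) atTop ≤ (κ : EReal))
    {Ω : Type*} [MeasurableSpace Ω] (P : Measure Ω) [IsProbabilityMeasure P]
    (A : (n : ℕ) → Ω → Matrix (Fin (numMeasurements κ n)) (Fin n) ℝ)
    (hindep : ∀ n, iIndepFun
      (fun (ij : Fin (numMeasurements κ n) × Fin n) (ω : Ω) => A n ω ij.1 ij.2) P)
    (hlaw : ∀ n i j,
      HasLaw (fun ω => A n ω i j) (gaussianReal 0 (1 / (numMeasurements κ n : NNReal))) P)
    (xhat : (n : ℕ) → Ω → Fin n → ℝ)
    (hxhat : ∀ n ω, IsMCPOutput U (resolution n) (A n ω)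
      ((A n ω).mulVec (fun i : Fin n => xo i)) (xhat n ω)) :
    ∀ ε : ℝ, 0 < ε →
      Tendsto (fun n : ℕ =>
        P {ω | ε < ‖WithLp.toLp 2 ((fun i : Fin n => xo i) - xhat n ω)‖ ^ 2}) atTop (𝓝 0) := by
  intro ε hε
  have hpos := hU.pos_of_limsup_le hκ
  obtain ⟨N, hN⟩ := exists_eventually_kolmogorovAt_le_numMeasurements hpos hκ
  -- `t = d ^ (-1/4)` tends to zero, as the small ball term requires, yet slowly enough that
  -- (1/d)/t² = d^(-1/2) also does.
  set t : ℕ → ℝ := fun d => (√√(d : ℝ))⁻¹ with ht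
  set bound : ℕ → ENNReal := fun d => ENNReal.ofReal ((1 + gaussianFourthMoment) * (√(d : ℝ))⁻¹) +
    ENNReal.ofReal ((2 ^ N * √(4 * Real.exp 1 / ε * t d)) ^ d) with hbound
  have hsqrt : Tendsto (fun d : ℕ => √(d : ℝ)) atTop atTop :=
    Real.tendsto_sqrt_atTop.comp tendsto_natCast_atTop_atTop
  have htlim : Tendsto t atTop (𝓝 0) :=
    tendsto_inv_atTop_zero.comp (Real.tendsto_sqrt_atTop.comp hsqrt)
  have hlim : Tendsto bound atTop (𝓝 0) := by
    have h1 : Tendsto (fun d : ℕ => (1 + gaussianFourthMoment) * (√(d : ℝ))⁻¹) atTop (𝓝 0) := by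
      simpa using (tendsto_inv_atTop_zero.comp hsqrt).const_mul (1 + gaussianFourthMoment)
    have h2 : Tendsto (fun d => 2 ^ N * √(4 * Real.exp 1 / ε * t d)) atTop (𝓝 0) := by
      simpa using ((htlim.const_mul (4 * Real.exp 1 / ε)).sqrt).const_mul ((2 : ℝ) ^ N)
    have h3 := tendsto_pow_self_of_tendsto_zero (fun d => by positivity) h2
    simpa using (ENNReal.tendsto_ofReal h1).add (ENNReal.tendsto_ofReal h3)
  refine tendsto_of_tendsto_of_tendsto_of_le_of_le' tendsto_const_nhds
    (hlim.comp (tendsto_numMeasurements hpos)) (Eventually.of_forall fun _ => zero_le) ?_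
  filter_upwards [hN, eventually_ge_atTop 1, eventually_numMeasurements_le κ,
    (tendsto_numMeasurements hpos).eventually_ge_atTop 1,
    tendsto_natCast_atTop_atTop.eventually_ge_atTop (4 / ε)] with n hK hn hdn hd hεn
  set d := numMeasurements κ n with hd_def
  have hd' : (0 : ℝ) < d := by exact_mod_cast hd
  have hn' : (0 : ℝ) < n := by exact_mod_cast hn
  have hdn' : (d : ℝ) ≤ n := by exact_mod_cast hdn
  have htd : 0 < t d := by positivity
  have hmain := hU.measure_mcp_error_le hd hn (natCast_le_two_pow_resolution hn) (hindep n)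
    (hlaw n) (fun i => hxo i) (hxhat n) htd hε ((div_le_iff₀' hε).1 hεn)
  have hset : {ω | ε < ‖WithLp.toLp 2 ((fun i : Fin n => xo i) - xhat n ω)‖ ^ 2} =
      {ω | ε < ∑ i : Fin n, (xo i - xhat n ω i) ^ 2} := by
    ext ω
    simp [EuclideanSpace.norm_sq_eq]
  rw [hset]
  refine hmain.trans (add_le_add (ENNReal.ofReal_le_ofReal ?_) (ENNReal.ofReal_le_ofReal ?_))
  · have ht2 : t d ^ 2 = (√(d : ℝ))⁻¹ := by
      rw [ht, inv_pow, Real.sq_sqrt (Real.sqrt_nonneg _)]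
    have hs : 0 < √(d : ℝ) := Real.sqrt_pos.2 hd'
    -- Since `d ≤ n`, replacing 1/n by 1/d makes the bound depend on `d` alone.
    calc _ ≤ (1 / d + gaussianFourthMoment / d) / t d ^ 2 := by gcongr
      _ = _ := by
        rw [ht2, ← add_div, div_inv_eq_mul, div_mul_eq_mul_div, mul_div_assoc,
          Real.sqrt_div_self', one_div]
  · rw [mul_pow, ← pow_mul]
    exact mul_le_mul_of_nonneg_right (pow_le_pow_right₀ one_le_two hK) (by positivity)
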